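/- Write $|\cdot|$ for the Euclidean norm on $\mathbb R^N$ and $B_r(z)$ for Euclidean balls. A convex function $g:\mathbb R^N\to[0,\infty)$ is called cylinder-like if for all $\bar x\ne\bar y$ in $\mathbb R^N$ with $g(\bar x)=g(\bar y)$ there are $\epsilon,\delta>0$ such that $g(x-\epsilon(\bar x-\bar y))\le g(x)$ for all $x\in B_\delta(\bar x)$ and $g(y+\epsilon(\bar x-\bar y))\le g(y)$ for all $y\in B_\delta(\bar y)$. Let $\|\cdot\|$ be a cylinder-like norm on $\mathbb R^N$, let $1<p<\infty$, and put $c(x,y)=\|y-x\|^p$. Let $\mu,\nu$ be Borel probability measures on $\mathbb R^N$ with finite $p$-th moments and $\mu\ll\mathscr L^N$. Let $\mathsf{Adm}(\mu,\nu)$ be the set of Borel probability measures on $\mathbb R^N\times\mathbb R^N$ with marginals $\mu$ and $\nu$, let $\mathscr C(\mu,\nu)=\inf_{\pi\in\mathsf{Adm}(\mu,\nu)}\int c\,d\pi$, let $\Pi_1(\mu,\nu)$ be the set of minimisers of $\int c\,d\pi$ over $\mathsf{Adm}(\mu,\nu)$, and let $\Pi_2(\mu,\nu)$ be the set of minimisers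 of $\int|x-y|^2\,d\pi$ over $\Pi_1(\mu,\nu)$ (integrals with values in $[0,\infty]$). A plan $\pi$ is induced by a map if $\pi=(\mathrm{id},T)_\#\mu$ for some $\mu$-measurable $T:\mathbb R^N\to\mathbb R^N$. Then: 1. $\mathscr C(\mu,\nu)<\infty$. 2. $\Pi_2(\mu,\nu)$ contains an element that is induced by a map; in particular an optimal transport map exists. 3. If $p\ge 2$, or if $1<p<2$ and $\inf_{\pi\in\Pi_1(\mu,\nu)}\int|x-y|^2\,d\pi<\infty$ (for instance if $\mu$ and $\nu$ have finite second moments), then $\Pi_2(\mu,\nu)$ has exactly one element, and it is induced by a map. Moreover, every norm on $\mathbb R^2$ is cylinder-like, and for every finite set $V\subset\mathbb R^N$ spanning $\mathbb R^N$ the crystalline norm $x\mapsto\max_{v\in V}|\langle x,v\rangle|$ is a norm and is cylinder-like. -/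

import Mathlib

open MeasureTheory
open scoped ENNReal

noncomputable section

namespace CylTransport

/-- `ℝ^N` with its Euclidean norm (so `‖·‖`, `edist`, `Metric.ball` are the Euclidean ones). -/
abbrev E (N : ℕ) : Type := EuclideanSpace ℝ (Fin N)

/-- A seminorm on `ℝ^N` that is a norm. -/
def IsNorm {N : ℕ} (n : Seminorm ℝ (E N)) : Prop :=
  ∀ x, n x = 0 → x = 0

/-- Cylinder-like convex functions `ℝ^N → [0, ∞)`. -/
def CylinderLike {N : ℕ} (g : E N → ℝ) : Prop :=
  (∀ x, 0 ≤ g x) ∧ ConvexOn ℝ Set.univ g ∧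
    ∀ x₀ y₀ : E N, x₀ ≠ y₀ → g x₀ = g y₀ →
      ∃ ε : ℝ, 0 < ε ∧ ∃ δ : ℝ, 0 < δ ∧
        (∀ x ∈ Metric.ball x₀ δ, g (x - ε • (x₀ - y₀)) ≤ g x) ∧
        (∀ y ∈ Metric.ball y₀ δ, g (y + ε • (x₀ - y₀)) ≤ g y)

/-- The crystalline norm `x ↦ max_{v ∈ V} |⟨v, x⟩|` of a finite set `V` of vectors. -/
def crystalline {N : ℕ} (V : Finset (E N)) : Seminorm ℝ (E N) :=
  V.sup fun v => (normSeminorm ℝ ℝ).comp (innerₗ (E N) v)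

theorem crystalline_apply {N : ℕ} (V : Finset (E N)) (hV : V.Nonempty) (x : E N) :
    crystalline V x = V.sup' hV fun v => |inner ℝ x v| := by
  apply le_antisymm
  · refine Seminorm.finset_sup_apply_le ?_ fun v hv => ?_
    · obtain ⟨v, hv⟩ := hV
      exact (abs_nonneg (inner ℝ x v)).trans
        (Finset.le_sup' (fun v => |inner ℝ x v|) hv)
    · have : ((normSeminorm ℝ ℝ).comp (innerₗ (E N) v)) x = |inner ℝ x v| := by
        simp [Seminorm.comp_apply, real_inner_comm]
      rw [this]
      exact Finset.le_sup' (fun v => |inner ℝ x v|) hv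
  · refine Finset.sup'_le _ _ fun v hv => ?_
    have h : ((normSeminorm ℝ ℝ).comp (innerₗ (E N) v)) ≤ crystalline V :=
      Finset.le_sup (f := fun v => (normSeminorm ℝ ℝ).comp (innerₗ (E N) v)) hv
    have := h x
    simpa [Seminorm.comp_apply, real_inner_comm] using this

/-- Admissible transport plans: couplings of `μ` and `ν`. -/
def Adm {N : ℕ} (μ ν : Measure (E N)) : Set (Measure (E N × E N)) :=
  {π | IsProbabilityMeasure π ∧ π.map Prod.fst = μ ∧ π.map Prod.snd = ν}

/-- The total cost `∫ c dπ` of a plan. -/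
def planCost {N : ℕ} (c : E N → E N → ℝ≥0∞) (π : Measure (E N × E N)) : ℝ≥0∞ :=
  ∫⁻ z, c z.1 z.2 ∂π

/-- The optimal transport cost from `μ` to `ν`. -/
def transportCost {N : ℕ} (c : E N → E N → ℝ≥0∞) (μ ν : Measure (E N)) : ℝ≥0∞ :=
  ⨅ π ∈ Adm μ ν, planCost c π

/-- Optimal plans: minimisers of the Kantorovich problem. -/
def Plans₁ {N : ℕ} (c : E N → E N → ℝ≥0∞) (μ ν : Measure (E N)) :
    Set (Measure (E N × E N)) :=
  {π | π ∈ Adm μ ν ∧ ∀ π' ∈ Adm μ ν, planCost c π ≤ planCost c π'}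

/-- The squared Euclidean distance. -/
def sqDist {N : ℕ} (x y : E N) : ℝ≥0∞ := edist x y ^ 2

/-- The value of the secondary variational problem. -/
def secondaryCost {N : ℕ} (c : E N → E N → ℝ≥0∞) (μ ν : Measure (E N)) : ℝ≥0∞ :=
  ⨅ π ∈ Plans₁ c μ ν, planCost sqDist π

/-- Minimisers of the secondary variational problem. -/
def Plans₂ {N : ℕ} (c : E N → E N → ℝ≥0∞) (μ ν : Measure (E N)) :
    Set (Measure (E N × E N)) :=
  {π | π ∈ Plans₁ c μ ν ∧ ∀ π' ∈ Plans₁ c μ ν, planCost sqDist π ≤ planCost sqDist π'}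

/-- The plan `π` is `(id, T)_# μ` for some `μ`-measurable map `T`. -/
def InducedByMap {N : ℕ} (μ : Measure (E N)) (π : Measure (E N × E N)) : Prop :=
  ∃ T : E N → E N, AEMeasurable T μ ∧ π = μ.map (fun x => (x, T x))

/-- The cost `c(x, y) = n(y - x)^p`. -/
def normCost {N : ℕ} (n : Seminorm ℝ (E N)) (p : ℝ) (x y : E N) : ℝ≥0∞ :=
  ENNReal.ofReal (n (y - x) ^ p)

/-- Finite moment of order `p`. -/
def FiniteMoment {N : ℕ} (p : ℝ) (μ : Measure (E N)) : Prop :=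
  ∫⁻ x, ENNReal.ofReal (‖x‖ ^ p) ∂μ < ∞

end CylTransport

end

namespace CylTransport

/-! Weak compactness gives an optimal plan that minimises the Euclidean cost among optimal plans;
disintegrate it over `μ`. If the conditional laws were not Dirac masses almost everywhere, a
countable cover of the off-diagonal by boxes would yield displacements `a ≠ b` with neighbourhoods
`U`, `V` both charged from every starting point of a set of positive measure. As `μ ≪ volume`, that
set contains many pairs `x`, `x + t • (a - b)` for arbitrarily small `t > 0`. Exchange the end
points of mass leaving `x` with displacement `z ∈ U` and mass leaving `x + t • (a - b)` with
displacement `w ∈ V`: the displacements become `z - t • (a - b)` and `w + t • (a - b)`. If `n a ≠ n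
b`, strict convexity of `r ^ p` makes the new plan strictly cheaper, against optimality. If `n a = n
b`, the cylinder-like condition keeps the cost from increasing while the Euclidean cost strictly
drops, against secondary minimality.

`CylinderLike.exists_isOpen_add_le` supplies these inequalities, `exists_coupling` and `exists_swap`
perform the exchange on measures, and `ae_condKernel_eq_zero_or` combines them. For uniqueness, the
average of two secondary minimisers is again one, hence lies on a graph, which forces both plans to
agree. If the secondary value is infinite, every optimal plan is a secondary minimiser, and the
argument is run with the finite cost `‖y - x‖ ^ p` in place of the squared distance. -/

/-- A convex function that does not increase after the step `-ε • d` does not increase after any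
shorter step in that direction. -/
theorem convexOn_sub_smul_le {N : ℕ} {g : E N → ℝ} (hg : ConvexOn ℝ Set.univ g) {ε t : ℝ}
    (hε : 0 < ε) (ht : 0 ≤ t) (htε : t ≤ ε) (x d : E N) :
    g (x - t • d) - g x ≤ t / ε * (g (x - ε • d) - g x) := by
  have h := hg.2 (Set.mem_univ x) (Set.mem_univ (x - ε • d))
    (sub_nonneg.2 ((div_le_one hε).2 htε)) (div_nonneg ht hε.le) (by ring)
  have hx : (1 - t / ε) • x + (t / ε) • (x - ε • d) = x - t • d := by
    rw [smul_sub, smul_smul, div_mul_cancel₀ _ hε.ne', sub_smul, one_smul]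
    abel
  rw [hx, smul_eq_mul, smul_eq_mul] at h
  linarith

/-- The condition at `y₀` is the one at `x₀` with the two points exchanged, and convexity lets both
hold with the smaller step. -/
theorem CylinderLike.of_sub {N : ℕ} {g : E N → ℝ} (h0 : ∀ x, 0 ≤ g x)
    (hg : ConvexOn ℝ Set.univ g)
    (h : ∀ x₀ y₀ : E N, x₀ ≠ y₀ → g x₀ = g y₀ → ∃ ε : ℝ, 0 < ε ∧ ∃ δ : ℝ, 0 < δ ∧
      ∀ x ∈ Metric.ball x₀ δ, g (x - ε • (x₀ - y₀)) ≤ g x) : CylinderLike g := by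
  refine ⟨h0, hg, fun x₀ y₀ hne heq => ?_⟩
  obtain ⟨ε, hε, δ, hδ, hx⟩ := h x₀ y₀ hne heq
  obtain ⟨ε', hε', δ', hδ', hy⟩ := h y₀ x₀ hne.symm heq.symm
  have key : ∀ {e x d}, 0 < e → min ε ε' ≤ e → g (x - e • d) ≤ g x →
      g (x - min ε ε' • d) ≤ g x := by
    intro e x d he hle hgx
    have := convexOn_sub_smul_le hg he (lt_min hε hε').le hle x d
    have h2 : min ε ε' / e * (g (x - e • d) - g x) ≤ 0 :=
      mul_nonpos_of_nonneg_of_nonpos (div_nonneg (lt_min hε hε').le he.le) (by linarith)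
    linarith
  refine ⟨min ε ε', lt_min hε hε', min δ δ', lt_min hδ hδ', fun x hxm => ?_, fun y hym => ?_⟩
  · exact key hε (min_le_left _ _)
      (hx x (Metric.ball_subset_ball (min_le_left _ _) hxm))
  · have := key hε' (min_le_right _ _)
      (hy y (Metric.ball_subset_ball (min_le_right _ _) hym))
    rwa [← neg_sub x₀ y₀, smul_neg, sub_neg_eq_add] at this

/-! ### Crystalline norms. -/

theorem seminorm_continuous {N : ℕ} (n : Seminorm ℝ (E N)) : Continuous n :=
  continuousOn_univ.1 (n.convexOn.continuousOn isOpen_univ)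

theorem abs_inner_le_crystalline {N : ℕ} {V : Finset (E N)} {v : E N} (hv : v ∈ V) (x : E N) :
    |inner ℝ x v| ≤ crystalline V x := by
  rw [crystalline_apply V ⟨v, hv⟩]
  exact Finset.le_sup' (fun v => |inner ℝ x v|) hv

theorem crystalline_le_iff {N : ℕ} {V : Finset (E N)} {x : E N} {r : ℝ} (hr : 0 ≤ r) :
    crystalline V x ≤ r ↔ ∀ v ∈ V, |inner ℝ x v| ≤ r := by
  refine ⟨fun h v hv => (abs_inner_le_crystalline hv x).trans h, fun h => ?_⟩
  refine Seminorm.finset_sup_apply_le hr fun v hv => ?_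
  simpa [Seminorm.comp_apply, real_inner_comm] using h v hv

theorem crystalline_isNorm {N : ℕ} {V : Finset (E N)}
    (hV : Submodule.span ℝ (V : Set (E N)) = ⊤) : IsNorm (crystalline V) := by
  intro x hx
  have h : ∀ v ∈ V, inner ℝ v x = 0 := fun v hv => by
    have := abs_inner_le_crystalline hv x
    rw [hx, real_inner_comm] at this
    exact abs_nonpos_iff.1 this
  have hmem : x ∈ Submodule.span ℝ (V : Set (E N)) := hV ▸ Submodule.mem_top
  have h2 : ∀ y ∈ Submodule.span ℝ (V : Set (E N)), inner ℝ y x = 0 := fun y hy =>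
    Submodule.span_induction (p := fun y _ => inner ℝ y x = 0) (fun v hv => h v hv)
      (inner_zero_left _) (fun a b _ _ ha hb => by rw [inner_add_left, ha, hb, add_zero])
      (fun c a _ ha => by rw [inner_smul_left, ha, mul_zero]) hy
  exact inner_self_eq_zero.1 (h2 x hmem)

/-- Treat each functional `± ⟨·, v⟩` separately. If it is below `g` at `x₀`, it stays below for
small steps by continuity. If it attains `g x₀ = g y₀`, it is at most that at `y₀`, so it does not
increase along `y₀ - x₀`. Finiteness of `V` makes the step uniform. -/
theorem crystalline_cylinderLike {N : ℕ} (V : Finset (E N)) : CylinderLike (crystalline V) := by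
  refine CylinderLike.of_sub (fun x => apply_nonneg _ x) (Seminorm.convexOn _) ?_
  intro x₀ y₀ _ heq
  set g := crystalline V with hg
  have hgc : Continuous g := seminorm_continuous _
  have step : ∀ᶠ q : ℝ × E N in nhds 0 ×ˢ nhds x₀, ∀ v ∈ V, ∀ s ∈ ({1, -1} : Finset ℝ),
      0 < q.1 → s * inner ℝ (q.2 - q.1 • (x₀ - y₀)) v ≤ g q.2 := by
    rw [← nhds_prod_eq]
    refine (Filter.eventually_all_finset V).2 fun v hv =>
      (Filter.eventually_all_finset _).2 fun s hs => ?_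
    have hs' : ∀ x, s * inner ℝ x v ≤ g x := fun x => by
      refine le_trans ?_ (abs_inner_le_crystalline hv x)
      rcases Finset.mem_insert.1 hs with rfl | hs
      · rw [one_mul]; exact le_abs_self _
      · rw [Finset.mem_singleton.1 hs, neg_one_mul]; exact neg_le_abs _
    rcases lt_or_eq_of_le (hs' x₀) with hlt | heq'
    · have hc1 : Continuous fun q : ℝ × E N => s * inner ℝ (q.2 - q.1 • (x₀ - y₀)) v := by
        fun_prop
      have hc2 : Continuous fun q : ℝ × E N => g q.2 := hgc.comp continuous_snd
      filter_upwards [(hc1.continuousAt (x := ((0 : ℝ), x₀))).eventually_lt hc2.continuousAt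
        (by simpa using hlt)] with q hq _ using hq.le
    · refine Filter.Eventually.of_forall fun q hq => ?_
      have h1 := hs' q.2
      have h2 := hs' y₀
      have h3 : 0 ≤ q.1 * (s * inner ℝ x₀ v - s * inner ℝ y₀ v) :=
        mul_nonneg hq.le (by rw [heq', heq]; linarith)
      rw [inner_sub_left, inner_smul_left, inner_sub_left]
      simp only [conj_trivial]
      linarith
  obtain ⟨ε, hε, δ, hδ, h⟩ := Filter.eventually_prod_iff.1 step |>.elim fun pa hpa => by
    obtain ⟨hpa, pb, hpb, h⟩ := hpa
    obtain ⟨r, hr, hr'⟩ := Metric.eventually_nhds_iff_ball.1 hpa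
    obtain ⟨δ, hδ, hδ'⟩ := Metric.eventually_nhds_iff_ball.1 hpb
    refine (⟨r / 2, half_pos hr, δ, hδ, fun x hx => h (hr' (r / 2) ?_) (hδ' x hx)⟩ :
      ∃ ε : ℝ, 0 < ε ∧ ∃ δ : ℝ, 0 < δ ∧ ∀ x ∈ Metric.ball x₀ δ, ∀ v ∈ V,
        ∀ s ∈ ({1, -1} : Finset ℝ), 0 < ε → s * inner ℝ (x - ε • (x₀ - y₀)) v ≤ g x)
    rw [mem_ball_zero_iff, Real.norm_eq_abs, abs_of_pos (half_pos hr)]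
    exact half_lt_self hr
  refine ⟨ε, hε, δ, hδ, fun x hx => (crystalline_le_iff (apply_nonneg _ _)).2 fun v hv => ?_⟩
  refine abs_le'.2 ⟨?_, ?_⟩
  · simpa using h x hx v hv 1 (by simp) hε
  · simpa using h x hx v hv (-1) (by simp) hε

/-! ### Norms on the plane. -/

/-- If a seminorm takes the same value at two points and at their midpoint, then it dominates the
linear function that takes this value at both points. -/
theorem add_mul_le_seminorm {N : ℕ} {n : Seminorm ℝ (E N)} {x₀ y₀ : E N} {m : ℝ}
    (hx : n x₀ = m) (hy : n y₀ = m) (hmid : n (x₀ - (1 / 2 : ℝ) • (x₀ - y₀)) = m)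
    {a : ℝ} (b : ℝ) (ha : 0 ≤ a) : (a + b) * m ≤ n (a • x₀ + b • y₀) := by
  have hsum : ∀ s : ℝ, 0 ≤ s → n (s • (x₀ + y₀)) = s * (2 * m) := fun s hs => by
    have : s • (x₀ + y₀) = (s * 2) • (x₀ - (1 / 2 : ℝ) • (x₀ - y₀)) := by module
    rw [this, map_smul_eq_mul, hmid, Real.norm_of_nonneg (by linarith)]
    ring
  -- Raising the smaller coefficient to the larger gives a multiple of `x₀ + y₀`, where `n` is
  -- known; the triangle inequality bounds the cost of the raise.
  rcases le_total b a with hb | hb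
  · have h1 := map_add_le_add n (a • x₀ + b • y₀) ((a - b) • y₀)
    have h2 : a • x₀ + b • y₀ + (a - b) • y₀ = a • (x₀ + y₀) := by module
    rw [h2, hsum a ha, map_smul_eq_mul, hy, Real.norm_of_nonneg (by linarith)] at h1
    linarith
  · have h1 := map_add_le_add n (a • x₀ + b • y₀) ((b - a) • x₀)
    have h2 : a • x₀ + b • y₀ + (b - a) • x₀ = b • (x₀ + y₀) := by module
    rw [h2, hsum b (ha.trans hb), map_smul_eq_mul, hx, Real.norm_of_nonneg (by linarith)] at h1
    linarith

/-- If the midpoint has smaller norm, continuity suffices. Otherwise `x₀`, `y₀` form a basis, and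
`n` dominates `(a + b) * m` for `a ≥ 0`, with equality on the cone `a, b ≥ 0`. Half a step from near
`x₀` lands in that cone without changing `a + b`. -/
theorem cylinderLike_of_isNorm_two {n : Seminorm ℝ (E 2)} (hn : IsNorm n) : CylinderLike n := by
  refine CylinderLike.of_sub (fun x => apply_nonneg _ x) n.convexOn ?_
  intro x₀ y₀ hne heq
  have hnc := seminorm_continuous n
  set m := n x₀ with hm
  have hm0 : 0 < m := by
    refine (apply_nonneg n x₀).lt_of_ne' fun h => hne ?_
    rw [hn x₀ h, hn y₀ (heq.symm.trans h)]
  have hmid : n (x₀ - (1 / 2 : ℝ) • (x₀ - y₀)) ≤ m := by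
    have h1 : x₀ - (1 / 2 : ℝ) • (x₀ - y₀) = (1 / 2 : ℝ) • x₀ + (1 / 2 : ℝ) • y₀ := by module
    have h2 := map_add_le_add n ((1 / 2 : ℝ) • x₀) ((1 / 2 : ℝ) • y₀)
    rw [map_smul_eq_mul, map_smul_eq_mul, ← heq, ← hm, Real.norm_of_nonneg (by norm_num)] at h2
    rw [h1]
    linarith
  rcases hmid.lt_or_eq with hlt | hmid
  · have hc : Continuous fun x : E 2 => n (x - (1 / 2 : ℝ) • (x₀ - y₀)) :=
      hnc.comp (by fun_prop)
    obtain ⟨δ, hδ, h⟩ := Metric.eventually_nhds_iff_ball.1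
      ((hc.continuousAt (x := x₀)).eventually_lt hnc.continuousAt hlt)
    exact ⟨1 / 2, by norm_num, δ, hδ, fun x hx => (h x hx).le⟩
  -- Equal norms leave only `y₀ = ± x₀`; one sign is excluded by `hne`, the other would make the
  -- midpoint vanish.
  have hli : LinearIndependent ℝ ![x₀, y₀] := by
    refine LinearIndependent.pair_iff.2 fun a b hab => ?_
    have habs : |a| = |b| := by
      have h1 : n (a • x₀) = n (b • y₀) := by
        rw [eq_neg_of_add_eq_zero_left hab, map_neg_eq_map]
      rw [map_smul_eq_mul, map_smul_eq_mul, ← heq, ← hm] at h1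
      exact mul_right_cancel₀ hm0.ne' h1
    have ha : a = 0 := by
      rcases abs_eq_abs.1 habs with rfl | rfl
      · have h1 := add_mul_le_seminorm hm.symm heq.symm hmid |a| (abs_nonneg a)
        have h2 : n (|a| • x₀ + |a| • y₀) = 0 := by
          rw [← smul_add, map_smul_eq_mul, Real.norm_eq_abs, abs_abs, ← Real.norm_eq_abs,
            ← map_smul_eq_mul, smul_add, hab, map_zero]
        rw [h2] at h1
        have h3 : |a| ≤ 0 := by nlinarith
        exact abs_nonpos_iff.1 h3
      · have h1 : b • (y₀ - x₀) = 0 := by rw [← hab]; module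
        rcases smul_eq_zero.1 h1 with h1 | h1
        · rw [h1, neg_zero]
        · exact absurd (sub_eq_zero.1 h1).symm hne
    subst ha
    exact ⟨rfl, abs_eq_zero.1 (by rw [← habs, abs_zero])⟩
  let B := basisOfLinearIndependentOfCardEqFinrank hli (by simp)
  have hB0 : B 0 = x₀ := by simp [B]
  have hB1 : B 1 = y₀ := by simp [B]
  have hrep : ∀ x, x = B.coord 0 x • x₀ + B.coord 1 x • y₀ := fun x => by
    conv_lhs => rw [← B.sum_repr x]
    rw [Fin.sum_univ_two, hB0, hB1]
    rfl
  have hc0 : Continuous (B.coord 0) := LinearMap.continuous_of_finiteDimensional _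
  have hc1 : Continuous (B.coord 1) := LinearMap.continuous_of_finiteDimensional _
  have e0 : B.coord 0 x₀ = 1 := by rw [← hB0]; simp
  have e1 : B.coord 1 x₀ = 0 := by rw [← hB0]; simp
  have hev0 : ∀ᶠ x in nhds x₀, 1 / 2 < B.coord 0 x :=
    (hc0.tendsto x₀).eventually_const_lt (by rw [e0]; norm_num)
  have hev1 : ∀ᶠ x in nhds x₀, -1 / 2 < B.coord 1 x :=
    (hc1.tendsto x₀).eventually_const_lt (by rw [e1]; norm_num)
  obtain ⟨δ, hδ, h⟩ := Metric.eventually_nhds_iff_ball.1 (hev0.and hev1)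
  refine ⟨1 / 2, by norm_num, δ, hδ, fun x hx => ?_⟩
  obtain ⟨h0, h1⟩ := h x hx
  set a := B.coord 0 x
  set b := B.coord 1 x
  rw [hrep x]
  refine le_trans ?_ (add_mul_le_seminorm hm.symm heq.symm hmid b (by linarith))
  have h2 : a • x₀ + b • y₀ - (1 / 2 : ℝ) • (x₀ - y₀) =
      (a - 1 / 2) • x₀ + (b + 1 / 2) • y₀ := by module
  rw [h2]
  refine (map_add_le_add n _ _).trans ?_
  rw [map_smul_eq_mul, map_smul_eq_mul, ← heq, ← hm, Real.norm_of_nonneg (by linarith),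
    Real.norm_of_nonneg (by linarith)]
  linarith

/-! ### Existence of primary and secondary minimisers. -/

/-- The integral is the supremum of those of the truncations `min (c z) n`, which are bounded and
continuous. -/
theorem lowerSemicontinuous_lintegral {Ω : Type*} [MeasurableSpace Ω] [TopologicalSpace Ω]
    [OpensMeasurableSpace Ω] {c : Ω → ℝ≥0∞} (hc : Continuous c) :
    LowerSemicontinuous fun π : ProbabilityMeasure Ω => ∫⁻ z, c z ∂(π : Measure Ω) := by
  have hsup : ∀ z, c z = ⨆ n : ℕ, min (c z) n := fun z => by
    rw [← inf_iSup_eq, ENNReal.iSup_natCast, inf_top_eq]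
  have hlim : ∀ π : ProbabilityMeasure Ω, ∫⁻ z, c z ∂(π : Measure Ω) =
      ⨆ n : ℕ, ∫⁻ z, min (c z) n ∂(π : Measure Ω) := fun π => by
    rw [← lintegral_iSup (fun n => hc.measurable.min measurable_const)
      (fun i j hij z => min_le_min_left _ (by exact_mod_cast hij))]
    exact lintegral_congr hsup
  simp_rw [hlim]
  refine lowerSemicontinuous_iSup fun n => Continuous.lowerSemicontinuous ?_
  have hne : ∀ z, min (c z) n ≠ ∞ := fun z =>
    ((min_le_right _ _).trans_lt (ENNReal.natCast_lt_top n)).ne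
  let f : BoundedContinuousFunction Ω NNReal := BoundedContinuousFunction.mkOfBound
    ⟨fun z => (min (c z) n).toNNReal, (ENNReal.continuousOn_toNNReal.comp_continuous
      (hc.min continuous_const) fun z => hne z)⟩ n (fun x y => by
      have : ∀ z, ((min (c z) n).toNNReal : ℝ) ≤ n := fun z => by
        exact_mod_cast ENNReal.toNNReal_mono (ENNReal.natCast_ne_top n) (min_le_right (c z) n)
      rw [NNReal.dist_eq]
      refine abs_sub_le_of_nonneg_of_le (NNReal.coe_nonneg _) (this x) (NNReal.coe_nonneg _)
        (this y))
  have hf : ∀ π : ProbabilityMeasure Ω, ∫⁻ z, min (c z) n ∂(π : Measure Ω) =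
      ∫⁻ z, f z ∂(π : Measure Ω) := fun π =>
    lintegral_congr fun z => (ENNReal.coe_toNNReal (hne z)).symm
  simp_rw [hf]
  exact continuous_iff_continuousAt.2 fun π =>
    ProbabilityMeasure.tendsto_iff_forall_lintegral_tendsto.1 Filter.tendsto_id f

section Existence

variable {N : ℕ} {μ ν : Measure (E N)}

theorem prod_mem_adm [IsProbabilityMeasure μ] [IsProbabilityMeasure ν] :
    μ.prod ν ∈ Adm μ ν := by
  refine ⟨inferInstance, ?_, ?_⟩
  · rw [Measure.map_fst_prod, measure_univ, one_smul]
  · rw [Measure.map_snd_prod, measure_univ, one_smul]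

/-- Prokhorov: fixed marginals give tightness, and taking marginals is weakly continuous. -/
theorem isCompact_adm [IsProbabilityMeasure μ] [IsProbabilityMeasure ν] :
    IsCompact {π : ProbabilityMeasure (E N × E N) | (π : Measure (E N × E N)) ∈ Adm μ ν} := by
  set S := {π : ProbabilityMeasure (E N × E N) | (π : Measure (E N × E N)) ∈ Adm μ ν} with hS
  have hclosed : IsClosed S := by
    have hS' : S = {π | π.map measurable_fst.aemeasurable = ⟨μ, inferInstance⟩} ∩
        {π | π.map measurable_snd.aemeasurable = ⟨ν, inferInstance⟩} := by
      ext π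
      constructor
      · rintro ⟨-, h1, h2⟩
        exact ⟨Subtype.ext h1, Subtype.ext h2⟩
      · rintro ⟨h1, h2⟩
        exact ⟨inferInstance, congrArg Subtype.val h1, congrArg Subtype.val h2⟩
    rw [hS']
    exact (isClosed_eq (ProbabilityMeasure.continuous_map continuous_fst) continuous_const).inter
      (isClosed_eq (ProbabilityMeasure.continuous_map continuous_snd) continuous_const)
  have htight : IsTightMeasureSet
      {((π : ProbabilityMeasure (E N × E N)) : Measure (E N × E N)) | π ∈ S} := by
    refine IsTightMeasureSet.prodMk
      ((isTightMeasureSet_singleton (μ := μ)).subset ?_)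
      ((isTightMeasureSet_singleton (μ := ν)).subset ?_)
    · rintro _ ⟨_, ⟨π, hπ, rfl⟩, rfl⟩
      exact hπ.2.1
    · rintro _ ⟨_, ⟨π, hπ, rfl⟩, rfl⟩
      exact hπ.2.2
  have := isCompact_closure_of_isTightMeasureSet htight
  rwa [hclosed.closure_eq] at this

/-- Among the optimal plans of a continuous cost there is one that minimises a second continuous
cost. -/
theorem exists_plans₁_forall_planCost_le [IsProbabilityMeasure μ] [IsProbabilityMeasure ν]
    {c k : E N → E N → ℝ≥0∞} (hc : Continuous fun z : E N × E N => c z.1 z.2)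
    (hk : Continuous fun z : E N × E N => k z.1 z.2) :
    ∃ π ∈ Plans₁ c μ ν, ∀ π' ∈ Plans₁ c μ ν, planCost k π ≤ planCost k π' := by
  have hne : {π : ProbabilityMeasure (E N × E N) |
      (π : Measure (E N × E N)) ∈ Adm μ ν}.Nonempty :=
    ⟨⟨μ.prod ν, inferInstance⟩, prod_mem_adm⟩
  obtain ⟨π₀, hπ₀, hmin⟩ := LowerSemicontinuousOn.exists_isMinOn hne isCompact_adm
    ((lowerSemicontinuous_lintegral hc).lowerSemicontinuousOn _)
  -- Optimal plans form a sublevel set of a lower semicontinuous function on a compact set, hence a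
  -- compact set on which to minimise again.
  have hopt : ∀ π : ProbabilityMeasure (E N × E N), (π : Measure (E N × E N)) ∈ Plans₁ c μ ν ↔
      π ∈ {π : ProbabilityMeasure (E N × E N) | (π : Measure (E N × E N)) ∈ Adm μ ν} ∩
        (fun π : ProbabilityMeasure (E N × E N) => ∫⁻ z, c z.1 z.2 ∂(π : Measure (E N × E N))) ⁻¹'
          Set.Iic (∫⁻ z, c z.1 z.2 ∂(π₀ : Measure (E N × E N))) := by
    intro π
    refine ⟨fun h => ⟨h.1, h.2 _ hπ₀⟩, fun h => ⟨h.1, fun π' hπ' => h.2.trans ?_⟩⟩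
    exact isMinOn_iff.1 hmin ⟨π', hπ'.1⟩ hπ'
  obtain ⟨π, hπ, hmin'⟩ := LowerSemicontinuousOn.exists_isMinOn
    (s := {π : ProbabilityMeasure (E N × E N) | (π : Measure (E N × E N)) ∈ Plans₁ c μ ν})
    ⟨π₀, (hopt _).2 ⟨hπ₀, le_rfl (a := ∫⁻ z, c z.1 z.2 ∂(π₀ : Measure (E N × E N)))⟩⟩
    (by
      simp only [hopt]
      exact isCompact_adm.inter_right ((lowerSemicontinuous_lintegral hc).isClosed_preimage _))
    ((lowerSemicontinuous_lintegral hk).lowerSemicontinuousOn _)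
  exact ⟨π, hπ, fun π' hπ' => isMinOn_iff.1 hmin' ⟨π', hπ'.1.1⟩ hπ'⟩

end Existence

open ProbabilityTheory

/-! ### Replacing a part of a plan. -/

section Competitor

variable {N : ℕ} {μ ν : Measure (E N)} {π m s : Measure (E N × E N)}

theorem sub_add_mem_adm (hπ : π ∈ Adm μ ν) (hm : m ≤ π)
    (h1 : m.map Prod.fst = s.map Prod.fst) (h2 : m.map Prod.snd = s.map Prod.snd) :
    π - m + s ∈ Adm μ ν := by
  have := hπ.1
  have : IsFiniteMeasure m := isFiniteMeasure_of_le π hm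
  have hadd : π - m + m = π := Measure.sub_add_cancel_of_le hm
  have e1 : (π - m + s).map Prod.fst = μ := by
    rw [Measure.map_add _ _ measurable_fst, ← h1, ← Measure.map_add _ _ measurable_fst, hadd,
      hπ.2.1]
  have e2 : (π - m + s).map Prod.snd = ν := by
    rw [Measure.map_add _ _ measurable_snd, ← h2, ← Measure.map_add _ _ measurable_snd, hadd,
      hπ.2.2]
  refine ⟨⟨?_⟩, e1, e2⟩
  have h3 : (π - m + s).map Prod.fst Set.univ = π.map Prod.fst Set.univ := by rw [e1, hπ.2.1]
  rwa [Measure.map_apply measurable_fst .univ, Measure.map_apply measurable_fst .univ,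
    Set.preimage_univ, measure_univ (μ := π)] at h3

theorem planCost_sub_add (f : E N → E N → ℝ≥0∞) [IsFiniteMeasure m] (hm : m ≤ π) :
    planCost f (π - m + s) + planCost f m = planCost f π + planCost f s := by
  have hadd : π - m + m = π := Measure.sub_add_cancel_of_le hm
  conv_rhs => rw [← hadd]
  simp only [planCost, lintegral_add_measure]
  ring

theorem planCost_mono (f : E N → E N → ℝ≥0∞) (hm : m ≤ π) : planCost f m ≤ planCost f π :=
  lintegral_mono' hm le_rfl

/-- A part of an optimal plan cannot be replaced by a cheaper one with the same marginals. -/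
theorem planCost_le_of_mem_plans₁ {c : E N → E N → ℝ≥0∞} (hπ : π ∈ Plans₁ c μ ν)
    (hfin : planCost c π < ∞) (hm : m ≤ π)
    (h1 : m.map Prod.fst = s.map Prod.fst) (h2 : m.map Prod.snd = s.map Prod.snd) :
    planCost c m ≤ planCost c s := by
  have := hπ.1.1
  have : IsFiniteMeasure m := isFiniteMeasure_of_le π hm
  have h := hπ.2 _ (sub_add_mem_adm hπ.1 hm h1 h2)
  refine (ENNReal.add_le_add_iff_left hfin.ne).1 ?_
  calc planCost c π + planCost c m ≤ planCost c (π - m + s) + planCost c m := by gcongr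
    _ = _ := planCost_sub_add c hm

/-- The hypothesis `hle` keeps the modified plan optimal, so it competes in the secondary problem.
-/
theorem planCost_le_of_secondary {c k : E N → E N → ℝ≥0∞} (hπ : π ∈ Plans₁ c μ ν)
    (hmin : ∀ π' ∈ Plans₁ c μ ν, planCost k π ≤ planCost k π')
    (hfin : planCost c π < ∞) (hfink : planCost k π < ∞) (hm : m ≤ π)
    (h1 : m.map Prod.fst = s.map Prod.fst) (h2 : m.map Prod.snd = s.map Prod.snd)
    (hle : planCost c s ≤ planCost c m) : planCost k m ≤ planCost k s := by
  have := hπ.1.1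
  have : IsFiniteMeasure m := isFiniteMeasure_of_le π hm
  have hc : planCost c (π - m + s) ≤ planCost c π := by
    refine (ENNReal.add_le_add_iff_right
      ((planCost_mono c hm).trans_lt hfin).ne).1 ?_
    rw [planCost_sub_add c hm]
    gcongr
  have h := hmin _ ⟨sub_add_mem_adm hπ.1 hm h1 h2, fun π' hπ' => hc.trans (hπ.2 π' hπ')⟩
  refine (ENNReal.add_le_add_iff_left hfink.ne).1 ?_
  calc planCost k π + planCost k m ≤ planCost k (π - m + s) + planCost k m := by gcongr
    _ = _ := planCost_sub_add k hm

end Competitor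

/-! ### Translates of sets of positive measure. -/

section Translation

variable {N : ℕ}

/-- A set of positive measure meets many of its small translates in positive measure. -/
theorem exists_volume_inter_translate_ne_zero {A : Set (E N)} (hA : MeasurableSet A)
    (hA0 : volume A ≠ 0) (d : E N) {ε : ℝ} (hε : 0 < ε) :
    ∃ t, 0 < t ∧ t ≤ ε ∧ volume (A ∩ (fun x => x + t • d) ⁻¹' A) ≠ 0 := by
  by_contra! hcon
  set t : ℕ → ℝ := fun n => ε / (n + 1) with ht
  have htpos : ∀ n, 0 < t n := fun n => by positivity
  have htle : ∀ n, t n ≤ ε := fun n => div_le_self hε.le (by simp)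
  -- Without the null set `Z`, what remains of `A` has positive measure but no two points differing
  -- by some `t n • d`, against Steinhaus.
  set Z := ⋃ n, A ∩ (fun x => x + t n • d) ⁻¹' A with hZ
  have hZ0 : volume Z = 0 := measure_iUnion_null fun n => hcon _ (htpos n) (htle n)
  have hZm : MeasurableSet Z := MeasurableSet.iUnion fun n =>
    hA.inter ((measurable_id.add_const _) hA)
  have hpos : 0 < volume (A \ Z) := by
    rw [measure_sdiff_null hZ0]
    exact pos_iff_ne_zero.2 hA0
  have hnhds := Measure.sub_mem_nhds_zero_of_addHaar_pos volume (A \ Z) (hA.diff hZm) hpos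
  have hlim : Filter.Tendsto (fun n => t n • d) Filter.atTop (nhds 0) := by
    have : Filter.Tendsto t Filter.atTop (nhds 0) :=
      tendsto_const_div_atTop_nhds_zero_nat ε |>.comp (Filter.tendsto_add_atTop_nat 1)
        |>.congr fun n => by simp [ht]
    simpa using this.smul_const d
  obtain ⟨n, hn⟩ := (hlim.eventually hnhds).exists
  obtain ⟨x, hx, y, hy, hxy⟩ := Set.mem_sub.1 hn
  refine hy.2 (Set.mem_iUnion.2 ⟨n, hy.1, ?_⟩)
  rw [Set.mem_preimage, ← hxy, add_sub_cancel]
  exact hx.1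

/-- On a piece where the density of `μ` is at least `1 / (n + 1)`, translation-invariant Lebesgue
measure can stand in for `μ`. -/
theorem exists_subset_restrict_volume_le {μ : Measure (E N)} [IsProbabilityMeasure μ]
    (hμ : μ ≪ volume) {A : Set (E N)} (hA : MeasurableSet A) (hA0 : μ A ≠ 0) :
    ∃ B ⊆ A, MeasurableSet B ∧ volume B ≠ 0 ∧
      ∃ M : ℝ≥0∞, M ≠ 0 ∧ M ≠ ∞ ∧ volume.restrict B ≤ M • μ := by
  set ρ := μ.rnDeriv volume with hρ
  have hρm : Measurable ρ := Measure.measurable_rnDeriv _ _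
  have hμρ : volume.withDensity ρ = μ := Measure.withDensity_rnDeriv_eq _ _ hμ
  set B : ℕ → Set (E N) := fun n => A ∩ {x | 1 ≤ ((n + 1 : ℕ) : ℝ≥0∞) * ρ x} with hB
  have hBm : ∀ n, MeasurableSet (B n) := fun n =>
    hA.inter (measurableSet_le measurable_const (hρm.const_mul _))
  obtain ⟨n, hn⟩ : ∃ n, volume (B n) ≠ 0 := by
    by_contra! hcon
    have h0 : volume (⋃ n, B n) = 0 := measure_iUnion_null hcon
    refine hA0 ?_
    have hsub : A ⊆ (⋃ n, B n) ∪ (A ∩ {x | ρ x = 0}) := by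
      intro x hx
      rcases eq_or_ne (ρ x) 0 with h | h
      · exact Or.inr ⟨hx, h⟩
      · left
        obtain ⟨n, hn⟩ := ENNReal.exists_nat_mul_gt h ENNReal.one_ne_top
        refine Set.mem_iUnion.2 ⟨n, hx, hn.le.trans ?_⟩
        gcongr
        exact n.le_succ
    refine measure_mono_null hsub (measure_union_null (hμ h0) ?_)
    have hm0 : MeasurableSet (A ∩ {x | ρ x = 0}) := hA.inter (hρm (measurableSet_singleton 0))
    rw [← hμρ, withDensity_apply _ hm0]
    exact (setLIntegral_congr_fun hm0 fun x hx => hx.2).trans (by simp)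
  refine ⟨B n, Set.inter_subset_left, hBm n, hn, (n + 1 : ℕ), by simp, ENNReal.natCast_ne_top _, ?_⟩
  refine Measure.le_iff.2 fun s hs => ?_
  rw [Measure.restrict_apply hs, Measure.smul_apply, smul_eq_mul]
  calc volume (s ∩ B n) = ∫⁻ _ in s ∩ B n, 1 := by simp
    _ ≤ ∫⁻ x in s ∩ B n, ((n + 1 : ℕ) : ℝ≥0∞) * ρ x :=
      setLIntegral_mono (hρm.const_mul _) fun x hx => hx.2.2
    _ = ((n + 1 : ℕ) : ℝ≥0∞) * μ (s ∩ B n) := by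
      rw [lintegral_const_mul _ hρm, ← withDensity_apply _ (hs.inter (hBm n)), hμρ]
    _ ≤ _ := by gcongr; exact Set.inter_subset_left

end Translation

/-! ### Marginals of couplings built from kernels. -/

section Coupling

variable {N : ℕ} {κ : Kernel (E N) (E N)} [IsMarkovKernel κ]
  {ρ : Measure (E N)} [SFinite ρ]

theorem compProd_prod_map_fst {η : Kernel (E N) (E N)} [IsMarkovKernel η] :
    (ρ ⊗ₘ (κ ×ₖ η)).map (fun p => (p.1, p.2.1)) = ρ ⊗ₘ κ := by
  ext s hs
  rw [Measure.map_apply (by fun_prop) hs, Measure.compProd_apply hs,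
    Measure.compProd_apply (measurableSet_preimage (by fun_prop) hs)]
  refine lintegral_congr fun x => ?_
  have : Prod.mk x ⁻¹' ((fun p : E N × E N × E N => (p.1, p.2.1)) ⁻¹' s) =
      (Prod.mk x ⁻¹' s) ×ˢ Set.univ := by
    ext y; simp
  rw [this, Kernel.prod_apply, Measure.prod_prod, measure_univ, mul_one]

theorem compProd_prod_map_snd {η : Kernel (E N) (E N)} [IsMarkovKernel η] (v : E N) :
    (ρ ⊗ₘ (η ×ₖ κ.comap (fun x => x + v) (measurable_id.add_const v))).map
      (fun p => (p.1 + v, p.2.2)) = (ρ.map fun x => x + v) ⊗ₘ κ := by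
  ext s hs
  rw [Measure.map_apply (by fun_prop) hs, Measure.compProd_apply hs,
    Measure.compProd_apply (measurableSet_preimage (by fun_prop) hs),
    lintegral_map (f := fun a => κ a (Prod.mk a ⁻¹' s))
      (Kernel.measurable_kernel_prodMk_left hs) (by fun_prop)]
  refine lintegral_congr fun x => ?_
  have : Prod.mk x ⁻¹' ((fun p : E N × E N × E N => (p.1 + v, p.2.2)) ⁻¹' s) =
      Set.univ ×ˢ (Prod.mk (x + v) ⁻¹' s) := by
    ext y; simp
  rw [this, Kernel.prod_apply, Measure.prod_prod, measure_univ, one_mul, Kernel.comap_apply]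

theorem compProd_le_smul {μ : Measure (E N)} [SFinite μ] {M : ℝ≥0∞} (h : ρ ≤ M • μ) :
    ρ ⊗ₘ κ ≤ M • (μ ⊗ₘ κ) := by
  refine Measure.le_iff.2 fun s hs => ?_
  rw [Measure.smul_apply, Measure.compProd_apply hs, Measure.compProd_apply hs,
    ← lintegral_smul_measure]
  exact lintegral_mono' h le_rfl

theorem map_restrict_volume_le {S B : Set (E N)} {v : E N} (hS : S ⊆ (fun x => x + v) ⁻¹' B) :
    (volume.restrict S).map (fun x => x + v) ≤ volume.restrict B := by
  have hmeas : Measurable fun x : E N => x + v := measurable_id.add_const v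
  refine Measure.le_iff.2 fun s hs => ?_
  rw [Measure.map_apply hmeas hs, Measure.restrict_apply (hmeas hs), Measure.restrict_apply hs]
  calc volume ((fun x => x + v) ⁻¹' s ∩ S) ≤ volume ((fun x => x + v) ⁻¹' (s ∩ B)) :=
        measure_mono fun x hx => ⟨hx.1, hS hx.2⟩
    _ = volume (s ∩ B) := measure_preimage_add_right _ _ _

end Coupling

/-! ### Exchanging end points. -/

section Swap

variable {N : ℕ} {μ ν : Measure (E N)} {π : Measure (E N × E N)}

/-- If the conditional laws of a plan charge both `x + U` and `x + V` with positive probability,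
then a part of the plan can be coupled to a part of itself so that the starting points differ by a
small vector `t • d`, with displacements in `U` and in `V` respectively. -/
theorem exists_coupling [IsProbabilityMeasure π] (hμ : π.fst ≪ volume) {U V : Set (E N)}
    (hU : MeasurableSet U) (hV : MeasurableSet V)
    (hpos : π.fst {x | π.condKernel x {y | y - x ∈ U} ≠ 0 ∧
      π.condKernel x {y | y - x ∈ V} ≠ 0} ≠ 0) (d : E N) {ε : ℝ} (hε : 0 < ε) :
    ∃ t, 0 < t ∧ t ≤ ε ∧ ∃ (γ : Measure (E N × E N × E N)) (M : ℝ≥0∞), M ≠ 0 ∧ M ≠ ∞ ∧ γ ≠ 0 ∧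
      (∀ᵐ p ∂γ, p.2.1 - p.1 ∈ U ∧ p.2.2 - (p.1 + t • d) ∈ V) ∧
      γ.map (fun p => (p.1, p.2.1)) ≤ M • π ∧
      γ.map (fun p => (p.1 + t • d, p.2.2)) ≤ M • π := by
  set κ := π.condKernel with hκ
  have hdis : π.fst ⊗ₘ κ = π := π.disintegrate κ
  have hmeas : ∀ {W : Set (E N)}, MeasurableSet W →
      MeasurableSet {q : E N × E N | q.2 - q.1 ∈ W} := fun hW =>
    (measurable_snd.sub measurable_fst) hW
  have hκm : ∀ {W : Set (E N)}, MeasurableSet W → Measurable fun x => κ x {y | y - x ∈ W} :=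
    fun hW => Kernel.measurable_kernel_prodMk_left (hmeas hW)
  obtain ⟨B, hBA, hBm, hB0, M, hM0, hM, hBM⟩ := exists_subset_restrict_volume_le hμ
    (((hκm hU) (measurableSet_singleton 0).compl).inter
      ((hκm hV) (measurableSet_singleton 0).compl)) hpos
  obtain ⟨t, ht, htε, htB⟩ := exists_volume_inter_translate_ne_zero hBm hB0 d hε
  set v := t • d
  set S := B ∩ (fun x => x + v) ⁻¹' B with hS
  have hSm : MeasurableSet S := hBm.inter ((by fun_prop : Measurable fun x : E N => x + v) hBm)
  let η : Kernel (E N) (E N) := κ.comap (fun x => x + v) (measurable_id.add_const v)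
  -- Given `x ∈ S`, the end points of mass from `x` and from `x + v` are drawn independently; this
  -- makes the event `G` positive.
  set γ₀ := volume.restrict S ⊗ₘ (κ ×ₖ η) with hγ₀
  set G := {p : E N × E N × E N | p.2.1 - p.1 ∈ U ∧ p.2.2 - (p.1 + v) ∈ V} with hG
  have hGm : MeasurableSet G :=
    ((by fun_prop : Measurable fun p : E N × E N × E N => p.2.1 - p.1) hU).inter
      ((by fun_prop : Measurable fun p : E N × E N × E N => p.2.2 - (p.1 + v)) hV)
  refine ⟨t, ht, htε, γ₀.restrict G, M, hM0, hM, ?_, ae_restrict_mem hGm, ?_, ?_⟩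
  · rw [Ne, Measure.restrict_eq_zero, hγ₀, Measure.compProd_apply hGm,
      lintegral_eq_zero_iff (Kernel.measurable_kernel_prodMk_left hGm)]
    intro hzero
    refine htB ?_
    have hfalse : ∀ᵐ x ∂volume.restrict S, False := by
      filter_upwards [hzero, ae_restrict_mem hSm] with x hx hxS
      have hset : Prod.mk x ⁻¹' G = {y | y - x ∈ U} ×ˢ {y | y - (x + v) ∈ V} := by
        ext y; simp [hG]
      rw [hset, Kernel.prod_apply, Measure.prod_prod] at hx
      rcases mul_eq_zero.1 hx with h | h
      · exact (hBA hxS.1).1 h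
      · exact (hBA hxS.2).2 h
    simpa [ae_iff] using hfalse
  · calc (γ₀.restrict G).map (fun p => (p.1, p.2.1)) ≤ γ₀.map (fun p => (p.1, p.2.1)) :=
          Measure.map_mono Measure.restrict_le_self (by fun_prop)
      _ = volume.restrict S ⊗ₘ κ := compProd_prod_map_fst
      _ ≤ M • (π.fst ⊗ₘ κ) := compProd_le_smul
          ((Measure.restrict_mono_set _ Set.inter_subset_left).trans hBM)
      _ = M • π := by rw [hdis]
  · calc (γ₀.restrict G).map (fun p => (p.1 + v, p.2.2)) ≤ γ₀.map (fun p => (p.1 + v, p.2.2)) :=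
          Measure.map_mono Measure.restrict_le_self (by fun_prop)
      _ = (volume.restrict S).map (fun x => x + v) ⊗ₘ κ := compProd_prod_map_snd v
      _ ≤ M • (π.fst ⊗ₘ κ) := compProd_le_smul
          ((map_restrict_volume_le Set.inter_subset_right).trans hBM)
      _ = M • π := by rw [hdis]

/-- A part of a plan coupled to another part of the plan, and the result of exchanging the end
points of the two parts. -/
theorem exists_swap {γ : Measure (E N × E N × E N)} {M : ℝ≥0∞} {v : E N}
    (hM0 : M ≠ 0) (hM : M ≠ ∞)
    (h1 : γ.map (fun p => (p.1, p.2.1)) ≤ M • π) (h2 : γ.map (fun p => (p.1 + v, p.2.2)) ≤ M • π) :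
    ∃ (m s : Measure (E N × E N)) (r : ℝ≥0∞), r ≠ 0 ∧ r ≠ ∞ ∧ m ≤ π ∧
      m.map Prod.fst = s.map Prod.fst ∧ m.map Prod.snd = s.map Prod.snd ∧
      ∀ f : E N → E N → ℝ≥0∞, Measurable (fun z : E N × E N => f z.1 z.2) →
        planCost f m = r * ∫⁻ p, (f p.1 p.2.1 + f (p.1 + v) p.2.2) ∂γ ∧
        planCost f s = r * ∫⁻ p, (f (p.1 + v) p.2.1 + f p.1 p.2.2) ∂γ := by
  have hr0 : (2 * M)⁻¹ ≠ 0 := ENNReal.inv_ne_zero.2 (ENNReal.mul_ne_top ENNReal.ofNat_ne_top hM)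
  have hr : (2 * M)⁻¹ ≠ ∞ := ENNReal.inv_ne_top.2 (mul_ne_zero two_ne_zero hM0)
  -- Each projection of `γ` is at most `M • π`, so the factor `(2 * M)⁻¹` puts their sum below `π`.
  refine ⟨(2 * M)⁻¹ • (γ.map (fun p => (p.1, p.2.1)) + γ.map (fun p => (p.1 + v, p.2.2))),
    (2 * M)⁻¹ • (γ.map (fun p => (p.1 + v, p.2.1)) + γ.map (fun p => (p.1, p.2.2))), (2 * M)⁻¹,
    hr0, hr, ?_, ?_, ?_, fun f hf => ⟨?_, ?_⟩⟩
  · calc _ ≤ (2 * M)⁻¹ • (M • π + M • π) := by gcongr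
      _ = π := by
        rw [← two_smul ℝ≥0∞ (M • π), smul_smul, smul_smul, mul_assoc,
          ENNReal.inv_mul_cancel (mul_ne_zero two_ne_zero hM0)
            (ENNReal.mul_ne_top ENNReal.ofNat_ne_top hM), one_smul]
  · simp only [Measure.map_smul, Measure.map_add _ _ measurable_fst]
    rw [Measure.map_map measurable_fst (by fun_prop), Measure.map_map measurable_fst (by fun_prop),
      Measure.map_map measurable_fst (by fun_prop), Measure.map_map measurable_fst (by fun_prop),
      add_comm]
    rfl
  · simp only [Measure.map_smul, Measure.map_add _ _ measurable_snd]
    rw [Measure.map_map measurable_snd (by fun_prop), Measure.map_map measurable_snd (by fun_prop),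
      Measure.map_map measurable_snd (by fun_prop), Measure.map_map measurable_snd (by fun_prop)]
    rfl
  · rw [planCost, lintegral_smul_measure, lintegral_add_measure, lintegral_map hf (by fun_prop),
      lintegral_map hf (by fun_prop), smul_eq_mul]
    exact congrArg _ (lintegral_add_left (hf.comp
      (by fun_prop : Measurable fun p : E N × E N × E N => (p.1, p.2.1))) _).symm
  · rw [planCost, lintegral_smul_measure, lintegral_add_measure, lintegral_map hf (by fun_prop),
      lintegral_map hf (by fun_prop), smul_eq_mul]
    exact congrArg _ (lintegral_add_left (hf.comp
      (by fun_prop : Measurable fun p : E N × E N × E N => (p.1 + v, p.2.1))) _).symm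

/-- The cost `ofReal (h (y - x))` of the displacement `y - x`. -/
noncomputable def dispCost (h : E N → ℝ) (x y : E N) : ℝ≥0∞ := ENNReal.ofReal (h (y - x))

theorem continuous_dispCost {h : E N → ℝ} (hh : Continuous h) :
    Continuous fun z : E N × E N => dispCost h z.1 z.2 :=
  ENNReal.continuous_ofReal.comp (hh.comp (continuous_snd.sub continuous_fst))

theorem dispCost_swap {h : E N → ℝ} (h0 : ∀ x, 0 ≤ h x) (x v y y' : E N) :
    dispCost h (x + v) y + dispCost h x y' =
      ENNReal.ofReal (h ((y - x) - v) + h ((y' - (x + v)) + v)) := by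
  rw [ENNReal.ofReal_add (h0 _) (h0 _), dispCost, dispCost, sub_sub, ← sub_sub, ← sub_sub,
    sub_add_cancel]

theorem dispCost_add {h : E N → ℝ} (h0 : ∀ x, 0 ≤ h x) (x v y y' : E N) :
    dispCost h x y + dispCost h (x + v) y' = ENNReal.ofReal (h (y - x) + h (y' - (x + v))) := by
  rw [ENNReal.ofReal_add (h0 _) (h0 _), dispCost, dispCost]

/-- Otherwise the exchange yields a part with the same marginals, no larger `h`-cost, and strictly
smaller `h`- or `k`-cost. Finiteness of the costs makes the strict integral inequality valid. -/
theorem ae_condKernel_eq_zero_or {h k : E N → ℝ} (hh : Continuous h) (hk : Continuous k)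
    (h0 : ∀ x, 0 ≤ h x) (k0 : ∀ x, 0 ≤ k x) (hμ : μ ≪ volume)
    (hπ : π ∈ Plans₁ (dispCost h) μ ν)
    (hmin : ∀ π' ∈ Plans₁ (dispCost h) μ ν, planCost (dispCost k) π ≤ planCost (dispCost k) π')
    (hfin : planCost (dispCost h) π < ∞) (hfink : planCost (dispCost k) π < ∞)
    [IsFiniteMeasure π]
    {U V : Set (E N)} (hU : MeasurableSet U) (hV : MeasurableSet V) (d : E N) {ε : ℝ} (hε : 0 < ε)
    (hle : ∀ t, 0 < t → t ≤ ε → ∀ z ∈ U, ∀ w ∈ V, h (z - t • d) + h (w + t • d) ≤ h z + h w)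
    (hlt : (∀ t, 0 < t → t ≤ ε → ∀ z ∈ U, ∀ w ∈ V, h (z - t • d) + h (w + t • d) < h z + h w) ∨
      ∀ t, 0 < t → t ≤ ε → ∀ z ∈ U, ∀ w ∈ V, k (z - t • d) + k (w + t • d) < k z + k w) :
    ∀ᵐ x ∂μ, π.condKernel x {y | y - x ∈ U} = 0 ∨ π.condKernel x {y | y - x ∈ V} = 0 := by
  have := hπ.1.1
  have hfst : π.fst = μ := hπ.1.2.1
  by_contra hcon
  have hpos : π.fst {x | π.condKernel x {y | y - x ∈ U} ≠ 0 ∧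
      π.condKernel x {y | y - x ∈ V} ≠ 0} ≠ 0 := by
    simpa [ae_iff, hfst] using hcon
  obtain ⟨t, ht, htε, γ, M, hM0, hM, hγ, hγUV, hγ1, hγ2⟩ :=
    exists_coupling (hfst ▸ hμ) hU hV hpos d hε
  obtain ⟨m, s, r, hr0, hr, hm, hms1, hms2, hcost⟩ := exists_swap hM0 hM hγ1 hγ2
  have hlt' : ∀ {f : E N → ℝ}, Continuous f → (∀ x, 0 ≤ f x) → planCost (dispCost f) π < ∞ →
      (∀ z ∈ U, ∀ w ∈ V, f (z - t • d) + f (w + t • d) < f z + f w) →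
      planCost (dispCost f) s < planCost (dispCost f) m := by
    intro f hf f0 hffin hflt
    obtain ⟨em, es⟩ := hcost _ (continuous_dispCost hf).measurable
    have hmfin : planCost (dispCost f) m < ∞ := (planCost_mono _ hm).trans_lt hffin
    have hae : ∀ᵐ p ∂γ, dispCost f (p.1 + t • d) p.2.1 + dispCost f p.1 p.2.2 <
        dispCost f p.1 p.2.1 + dispCost f (p.1 + t • d) p.2.2 := by
      filter_upwards [hγUV] with p hp
      rw [dispCost_swap f0, dispCost_add f0]
      have := hflt _ hp.1 _ hp.2
      exact (ENNReal.ofReal_lt_ofReal_iff_of_nonneg (add_nonneg (f0 _) (f0 _))).2 this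
    rw [em] at hmfin
    have hI : ∫⁻ p, (dispCost f p.1 p.2.1 + dispCost f (p.1 + t • d) p.2.2) ∂γ ≠ ∞ := fun h =>
      by simp [h, ENNReal.mul_top hr0] at hmfin
    rw [em, es]
    refine (ENNReal.mul_lt_mul_iff_right hr0 hr).2 ?_
    have hcf := continuous_dispCost hf
    refine lintegral_strict_mono hγ ?_ ?_ hae
    · exact ((hcf.comp (by fun_prop : Continuous fun p : E N × E N × E N => (p.1, p.2.1))).add
        (hcf.comp (by fun_prop :
          Continuous fun p : E N × E N × E N => (p.1 + t • d, p.2.2)))).measurable.aemeasurable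
    · exact ((lintegral_mono_ae (hae.mono fun p hp => hp.le)).trans_lt hI.lt_top).ne
  have hle' : planCost (dispCost h) s ≤ planCost (dispCost h) m := by
    obtain ⟨em, es⟩ := hcost _ (continuous_dispCost hh).measurable
    rw [em, es]
    gcongr r * ?_
    refine lintegral_mono_ae ?_
    filter_upwards [hγUV] with p hp
    rw [dispCost_swap h0, dispCost_add h0]
    exact ENNReal.ofReal_le_ofReal (hle t ht htε _ hp.1 _ hp.2)
  rcases hlt with hlt | hlt
  · exact (hlt' hh h0 hfin (hlt t ht htε)).not_ge (planCost_le_of_mem_plans₁ hπ hfin hm hms1 hms2)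
  · exact (hlt' hk k0 hfink (hlt t ht htε)).not_ge
      (planCost_le_of_secondary hπ hmin hfin hfink hm hms1 hms2 hle')

end Swap

/-! ### Convexity inequalities for displacements. -/

section Convexity

variable {N : ℕ}

/-- A strict midpoint inequality for a continuous convex function gives a strict decrease when two
points near the given ones are moved towards each other. -/
theorem exists_isOpen_add_lt {f : E N → ℝ} (hf : Continuous f) (hconv : ConvexOn ℝ Set.univ f)
    {a b : E N} (hlt : 2 * f (a - (1 / 2 : ℝ) • (a - b)) < f a + f b) :
    ∃ U V : Set (E N), IsOpen U ∧ IsOpen V ∧ a ∈ U ∧ b ∈ V ∧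
      ∀ t : ℝ, 0 < t → t ≤ 1 / 2 → ∀ z ∈ U, ∀ w ∈ V,
        f (z - t • (a - b)) + f (w + t • (a - b)) < f z + f w := by
  set d := a - b with hd
  have hb : b + (1 / 2 : ℝ) • d = a - (1 / 2 : ℝ) • d := by rw [hd]; module
  have hO : IsOpen {q : E N × E N |
      f (q.1 - (1 / 2 : ℝ) • d) + f (q.2 + (1 / 2 : ℝ) • d) < f q.1 + f q.2} :=
    isOpen_lt (by fun_prop) (by fun_prop)
  obtain ⟨U, V, hU, hV, haU, hbV, hUV⟩ := isOpen_prod_iff.1 hO a b (by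
    rw [Set.mem_ofPred_eq, hb]; linarith)
  refine ⟨U, V, hU, hV, haU, hbV, fun t ht ht2 z hz w hw => ?_⟩
  have h1 := convexOn_sub_smul_le hconv (by norm_num : (0 : ℝ) < 1 / 2) ht.le ht2 z d
  have h2 := convexOn_sub_smul_le hconv (by norm_num : (0 : ℝ) < 1 / 2) ht.le ht2 w (-d)
  have h3 : f (z - (1 / 2 : ℝ) • d) + f (w + (1 / 2 : ℝ) • d) < f z + f w := hUV (Set.mk_mem_prod hz hw)
  simp only [smul_neg, sub_neg_eq_add] at h2
  have h4 : t / (1 / 2) * (f (z - (1 / 2 : ℝ) • d) - f z + (f (w + (1 / 2 : ℝ) • d) - f w)) < 0 :=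
    mul_neg_of_pos_of_neg (by positivity) (by linarith)
  rw [mul_add] at h4
  linarith

variable (n : Seminorm ℝ (E N)) {p : ℝ}

theorem continuous_seminorm_rpow (hp : 1 < p) : Continuous fun x => n x ^ p :=
  (seminorm_continuous n).rpow_const fun _ => Or.inr (by linarith)

theorem convexOn_seminorm_rpow (hp : 1 < p) : ConvexOn ℝ Set.univ fun x => n x ^ p := by
  refine ⟨convex_univ, fun x _ y _ s t hs ht hst => ?_⟩
  have h1 : n (s • x + t • y) ≤ s • n x + t • n y := n.convexOn.2 trivial trivial hs ht hst
  exact (Real.rpow_le_rpow (apply_nonneg _ _) h1 (by linarith)).trans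
    ((convexOn_rpow hp.le).2 (apply_nonneg n x) (apply_nonneg n y) hs ht hst)

theorem sub_half_smul_sub (a b : E N) :
    a - (1 / 2 : ℝ) • (a - b) = (1 / 2 : ℝ) • a + (1 / 2 : ℝ) • b := by module

theorem seminorm_rpow_midpoint_lt (hp : 1 < p) {a b : E N} (hab : n a ≠ n b) :
    2 * n (a - (1 / 2 : ℝ) • (a - b)) ^ p < n a ^ p + n b ^ p := by
  rw [sub_half_smul_sub]
  have h1 : n ((1 / 2 : ℝ) • a + (1 / 2 : ℝ) • b) ≤ (1 / 2 : ℝ) • n a + (1 / 2 : ℝ) • n b :=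
    n.convexOn.2 trivial trivial (by norm_num) (by norm_num) (by norm_num)
  have h2 := (strictConvexOn_rpow hp).2 (apply_nonneg n a) (apply_nonneg n b) hab
    (by norm_num : (0 : ℝ) < 1 / 2) (by norm_num : (0 : ℝ) < 1 / 2) (by norm_num)
  have h3 := (Real.rpow_le_rpow (apply_nonneg _ _) h1 (by linarith : 0 ≤ p)).trans_lt h2
  simp only [smul_eq_mul] at h3
  linarith

/-- For equal norms use strict convexity of the Euclidean ball, for different norms that of `r ^ p`.
-/
theorem norm_rpow_midpoint_lt (hp : 1 < p) {a b : E N} (hab : a ≠ b) :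
    2 * ‖a - (1 / 2 : ℝ) • (a - b)‖ ^ p < ‖a‖ ^ p + ‖b‖ ^ p := by
  by_cases h : ‖a‖ = ‖b‖
  · have h1 : ‖(1 / 2 : ℝ) • a + (1 / 2 : ℝ) • b‖ < ‖b‖ :=
      norm_combo_lt_of_ne h.le le_rfl hab (by norm_num) (by norm_num) (by norm_num)
    have h2 := Real.rpow_lt_rpow (norm_nonneg _) h1 (by linarith : 0 < p)
    rw [sub_half_smul_sub, h]
    linarith
  · exact seminorm_rpow_midpoint_lt (normSeminorm ℝ (E N)) hp h

/-- Near two distinct displacements, moving them towards each other does not increase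
`n ^ p`, and strictly decreases either `n ^ p` or `‖·‖ ^ q`. -/
theorem CylinderLike.exists_isOpen_add_le {n : Seminorm ℝ (E N)} (hn : CylinderLike n)
    (hp : 1 < p) {q : ℝ} (hq : 1 < q) {a b : E N} (hab : a ≠ b) :
    ∃ U V : Set (E N), IsOpen U ∧ IsOpen V ∧ a ∈ U ∧ b ∈ V ∧ ∃ ε : ℝ, 0 < ε ∧
      (∀ t, 0 < t → t ≤ ε → ∀ z ∈ U, ∀ w ∈ V,
        n (z - t • (a - b)) ^ p + n (w + t • (a - b)) ^ p ≤ n z ^ p + n w ^ p) ∧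
      ((∀ t, 0 < t → t ≤ ε → ∀ z ∈ U, ∀ w ∈ V,
        n (z - t • (a - b)) ^ p + n (w + t • (a - b)) ^ p < n z ^ p + n w ^ p) ∨
      ∀ t, 0 < t → t ≤ ε → ∀ z ∈ U, ∀ w ∈ V,
        ‖z - t • (a - b)‖ ^ q + ‖w + t • (a - b)‖ ^ q < ‖z‖ ^ q + ‖w‖ ^ q) := by
  by_cases heq : n a = n b
  · obtain ⟨ε, hε, δ, hδ, h1, h2⟩ := hn.2.2 a b hab heq
    obtain ⟨U, V, hU, hV, haU, hbV, h⟩ := exists_isOpen_add_lt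
      (continuous_seminorm_rpow (normSeminorm ℝ (E N)) hq)
      (convexOn_seminorm_rpow (normSeminorm ℝ (E N)) hq) (norm_rpow_midpoint_lt hq hab)
    refine ⟨U ∩ Metric.ball a δ, V ∩ Metric.ball b δ, hU.inter Metric.isOpen_ball,
      hV.inter Metric.isOpen_ball, ⟨haU, Metric.mem_ball_self hδ⟩, ⟨hbV, Metric.mem_ball_self hδ⟩,
      min ε (1 / 2), by positivity, fun t ht htε z hz w hw => ?_,
      Or.inr fun t ht htε z hz w hw => h t ht (htε.trans (min_le_right _ _)) z hz.1 w hw.1⟩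
    have htε' := htε.trans (min_le_left _ _)
    have step : ∀ {x d}, n (x - ε • d) ≤ n x → n (x - t • d) ≤ n x := fun {x d} hx => by
      have h3 := convexOn_sub_smul_le n.convexOn hε ht.le htε' x d
      have h4 : t / ε * (n (x - ε • d) - n x) ≤ 0 :=
        mul_nonpos_of_nonneg_of_nonpos (by positivity) (by linarith)
      linarith
    have hz' := step (h1 z hz.2)
    have hw' : n (w + t • (a - b)) ≤ n w := by
      have := step (x := w) (d := -(a - b)) (by
        rw [smul_neg, sub_neg_eq_add]; exact h2 w hw.2)
      rwa [smul_neg, sub_neg_eq_add] at this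
    exact add_le_add (Real.rpow_le_rpow (apply_nonneg _ _) hz' (by linarith))
      (Real.rpow_le_rpow (apply_nonneg _ _) hw' (by linarith))
  · obtain ⟨U, V, hU, hV, haU, hbV, h⟩ := exists_isOpen_add_lt
      (continuous_seminorm_rpow n hp) (convexOn_seminorm_rpow n hp)
      (seminorm_rpow_midpoint_lt n hp heq)
    exact ⟨U, V, hU, hV, haU, hbV, 1 / 2, by norm_num,
      fun t ht htε z hz w hw => (h t ht htε z hz w hw).le, Or.inl h⟩

end Convexity

/-! ### From conditional laws to maps, and uniqueness. -/

section InducedByMap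

variable {N : ℕ} {μ ν : Measure (E N)} {π : Measure (E N × E N)}

/-- By Fubini, some section of the off-diagonal, the complement of a point, is `m`-null. -/
theorem exists_eq_dirac {m : Measure (E N)} [IsProbabilityMeasure m]
    (h : m.prod m {q | q.1 ≠ q.2} = 0) : ∃ y, m = Measure.dirac y := by
  have hms : MeasurableSet {q : E N × E N | q.1 ≠ q.2} :=
    (measurableSet_eq_fun measurable_fst measurable_snd).compl
  obtain ⟨y, hy⟩ := ((Measure.measure_prod_null hms).1 h).exists
  refine ⟨y, ?_⟩
  have hae : (fun x => x) =ᵐ[m] fun _ => y := by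
    refine measure_mono_null (fun x hx => ?_) hy
    exact fun h => hx h.symm
  calc m = m.map (fun x => x) := Measure.map_id.symm
    _ = m.map (fun _ => y) := Measure.map_congr hae
    _ = Measure.dirac y := by rw [Measure.map_const, measure_univ, one_smul]

/-- The barycentre of the conditional law selects the Dirac point measurably. -/
theorem inducedByMap_of_ae_eq_dirac [IsFiniteMeasure π] (hfst : π.fst = μ)
    (h : ∀ᵐ x ∂μ, ∃ y, π.condKernel x = Measure.dirac y) : InducedByMap μ π := by
  have hT : StronglyMeasurable fun x => ∫ y, y ∂π.condKernel x :=
    (stronglyMeasurable_id.comp_measurable measurable_snd).integral_kernel_prod_right'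
  refine ⟨fun x => ∫ y, y ∂π.condKernel x, hT.measurable.aemeasurable, ?_⟩
  have hdis : π.fst ⊗ₘ π.condKernel = π := π.disintegrate π.condKernel
  have hfin : IsFiniteMeasure μ := hfst ▸ inferInstance
  rw [← Measure.compProd_deterministic hT.measurable]
  conv_lhs => rw [← hdis, hfst]
  refine Measure.compProd_congr ?_
  filter_upwards [h] with x ⟨y, hy⟩
  rw [Kernel.deterministic_apply, hy, integral_dirac]

/-- Optimal plans that minimise a secondary strictly convex cost are induced by maps. -/
theorem CylinderLike.inducedByMap {n : Seminorm ℝ (E N)} (hn : CylinderLike n) {p q : ℝ}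
    (hp : 1 < p) (hq : 1 < q) (hμ : μ ≪ volume)
    (hπ : π ∈ Plans₁ (dispCost fun x => n x ^ p) μ ν)
    (hmin : ∀ π' ∈ Plans₁ (dispCost fun x => n x ^ p) μ ν,
      planCost (dispCost fun x => ‖x‖ ^ q) π ≤ planCost (dispCost fun x => ‖x‖ ^ q) π')
    (hfin : planCost (dispCost fun x => n x ^ p) π < ∞)
    (hfinq : planCost (dispCost fun x => ‖x‖ ^ q) π < ∞) : InducedByMap μ π := by
  have := hπ.1.1
  refine inducedByMap_of_ae_eq_dirac hπ.1.2.1 ?_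
  have hloc : ∀ z : {z : E N × E N // z.1 ≠ z.2}, ∃ U V : Set (E N), IsOpen U ∧ IsOpen V ∧
      z.1.1 ∈ U ∧ z.1.2 ∈ V ∧
      ∀ᵐ x ∂μ, π.condKernel x {y | y - x ∈ U} = 0 ∨ π.condKernel x {y | y - x ∈ V} = 0 := by
    rintro ⟨⟨a, b⟩, hab⟩
    obtain ⟨U, V, hU, hV, haU, hbV, ε, hε, hle, hlt⟩ := hn.exists_isOpen_add_le hp hq hab
    exact ⟨U, V, hU, hV, haU, hbV, ae_condKernel_eq_zero_or (continuous_seminorm_rpow n hp)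
      (continuous_seminorm_rpow (normSeminorm ℝ (E N)) hq)
      (fun x => Real.rpow_nonneg (apply_nonneg n x) p)
      (fun x => Real.rpow_nonneg (norm_nonneg x) q) hμ hπ hmin hfin hfinq
      hU.measurableSet hV.measurableSet (a - b) hε hle hlt⟩
  choose U V hU hV haU hbV hUV using hloc
  -- Lindelöf: countably many boxes cover the off-diagonal, so the exceptional null sets can be
  -- united.
  obtain ⟨T, hT, hcover⟩ := TopologicalSpace.isOpen_iUnion_countable
    (fun z => U z ×ˢ V z) fun z => (hU z).prod (hV z)
  filter_upwards [(ae_ball_iff hT).2 fun z _ => hUV z] with x hx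
  refine exists_eq_dirac (measure_mono_null (t := ⋃ z ∈ T,
    {y | y - x ∈ U z} ×ˢ {y | y - x ∈ V z}) ?_ ?_)
  · rintro ⟨y, y'⟩ hy
    have hne : y - x ≠ y' - x := fun h => hy (sub_left_injective h)
    have hmem : (y - x, y' - x) ∈ ⋃ z ∈ T, U z ×ˢ V z := by
      rw [hcover]
      exact Set.mem_iUnion.2 ⟨⟨(y - x, y' - x), hne⟩, haU _, hbV _⟩
    simpa using hmem
  · refine (measure_biUnion_null_iff hT).2 fun z hz => ?_
    rw [Measure.prod_prod, mul_eq_zero]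
    exact hx z hz

/-- Two plans whose average is induced by a map coincide. -/
theorem eq_of_inducedByMap_average {π' : Measure (E N × E N)} (hπ : π ∈ Adm μ ν)
    (hπ' : π' ∈ Adm μ ν) (h : InducedByMap μ ((2⁻¹ : ℝ≥0∞) • (π + π'))) : π = π' := by
  obtain ⟨T₀, hT₀, heq⟩ := h
  set T := hT₀.mk T₀
  have hT : Measurable T := hT₀.measurable_mk
  have hgraph : Measurable fun x => (x, T x) := measurable_id.prodMk hT
  have heq' : (2⁻¹ : ℝ≥0∞) • (π + π') = μ.map fun x => (x, T x) := by
    rw [heq]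
    refine Measure.map_congr ?_
    filter_upwards [hT₀.ae_eq_mk] with x hx
    rw [hx]
  have hms : MeasurableSet {z : E N × E N | z.2 ≠ T z.1} :=
    (measurableSet_eq_fun measurable_snd (hT.comp measurable_fst)).compl
  -- Both plans are carried by the graph on which their average lives, and a plan on a graph is
  -- determined by its first marginal.
  have hnull : (π + π') {z : E N × E N | z.2 ≠ T z.1} = 0 := by
    have h1 : ((2⁻¹ : ℝ≥0∞) • (π + π')) {z : E N × E N | z.2 ≠ T z.1} = 0 := by
      rw [heq', Measure.map_apply hgraph hms]
      simp
    rw [Measure.smul_apply, smul_eq_mul, mul_eq_zero] at h1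
    exact h1.resolve_left (by simp)
  rw [Measure.add_apply, add_eq_zero] at hnull
  have key : ∀ {m : Measure (E N × E N)}, m.map Prod.fst = μ →
      m {z : E N × E N | z.2 ≠ T z.1} = 0 → m = μ.map fun x => (x, T x) := by
    intro m hm h0
    have hae : (fun z : E N × E N => z) =ᵐ[m] fun z => (z.1, T z.1) := by
      filter_upwards [show ∀ᵐ z ∂m, z.2 = T z.1 from h0] with z hz
      rw [← hz]
    calc m = m.map (fun z => z) := Measure.map_id.symm
      _ = m.map (fun z => (z.1, T z.1)) := Measure.map_congr hae
      _ = (m.map Prod.fst).map fun x => (x, T x) := (Measure.map_map hgraph measurable_fst).symm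
      _ = _ := by rw [hm]
  rw [key hπ.2.1 hnull.1, key hπ'.2.1 hnull.2]

theorem average_mem_adm {π' : Measure (E N × E N)} (hπ : π ∈ Adm μ ν) (hπ' : π' ∈ Adm μ ν) :
    (2⁻¹ : ℝ≥0∞) • (π + π') ∈ Adm μ ν := by
  have := hπ.1
  have := hπ'.1
  have havg : ∀ m : Measure (E N), (2⁻¹ : ℝ≥0∞) • (m + m) = m := fun m => by
    rw [← two_smul ℝ≥0∞ m, smul_smul, ENNReal.inv_mul_cancel two_ne_zero ENNReal.ofNat_ne_top,
      one_smul]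
  refine ⟨⟨?_⟩, ?_, ?_⟩
  · rw [Measure.smul_apply, Measure.add_apply, measure_univ, measure_univ, one_add_one_eq_two,
      smul_eq_mul, ENNReal.inv_mul_cancel two_ne_zero ENNReal.ofNat_ne_top]
  · rw [Measure.map_smul, Measure.map_add _ _ measurable_fst, hπ.2.1, hπ'.2.1, havg]
  · rw [Measure.map_smul, Measure.map_add _ _ measurable_snd, hπ.2.2, hπ'.2.2, havg]

theorem planCost_average {π' : Measure (E N × E N)} {f : E N → E N → ℝ≥0∞}
    (h : planCost f π = planCost f π') : planCost f ((2⁻¹ : ℝ≥0∞) • (π + π')) = planCost f π := by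
  have : planCost f ((2⁻¹ : ℝ≥0∞) • (π + π')) = 2⁻¹ * (planCost f π + planCost f π') := by
    simp only [planCost, lintegral_smul_measure, lintegral_add_measure, smul_eq_mul]
  rw [this, ← h, ← two_mul, ← mul_assoc,
    ENNReal.inv_mul_cancel two_ne_zero ENNReal.ofNat_ne_top, one_mul]

theorem average_mem_plans₂ {π' : Measure (E N × E N)} {c : E N → E N → ℝ≥0∞}
    (hπ : π ∈ Plans₂ c μ ν) (hπ' : π' ∈ Plans₂ c μ ν) :
    (2⁻¹ : ℝ≥0∞) • (π + π') ∈ Plans₂ c μ ν := by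
  have e1 := planCost_average
    (le_antisymm (hπ.1.2 π' hπ'.1.1) (hπ'.1.2 π hπ.1.1))
  have e2 := planCost_average
    (le_antisymm (hπ.2 π' hπ'.1) (hπ'.2 π hπ.1))
  refine ⟨⟨average_mem_adm hπ.1.1 hπ'.1.1, ?_⟩, ?_⟩
  · rw [e1]; exact hπ.1.2
  · rw [e2]; exact hπ.2

end InducedByMap

/-! ### Finite costs from finite moments. -/

section Moments

variable {N : ℕ} {μ ν : Measure (E N)} {π : Measure (E N × E N)}

theorem norm_sub_rpow_le {p : ℝ} (hp : 1 < p) (x y : E N) :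
    ‖y - x‖ ^ p ≤ 2 ^ p * (‖x‖ ^ p + ‖y‖ ^ p) := by
  have hmax : ‖y - x‖ ≤ 2 * max ‖x‖ ‖y‖ :=
    (norm_sub_le y x).trans (by linarith [le_max_left ‖x‖ ‖y‖, le_max_right ‖x‖ ‖y‖])
  have h0 : 0 ≤ max ‖x‖ ‖y‖ := (norm_nonneg x).trans (le_max_left _ _)
  refine (Real.rpow_le_rpow (norm_nonneg _) hmax (by linarith)).trans ?_
  rw [Real.mul_rpow zero_le_two h0]
  gcongr
  have hx := Real.rpow_nonneg (norm_nonneg x) p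
  have hy := Real.rpow_nonneg (norm_nonneg y) p
  rcases max_choice ‖x‖ ‖y‖ with h | h <;> rw [h] <;> linarith

theorem planCost_dispCost_lt_top {p : ℝ} (hp : 1 < p) (hμ : FiniteMoment p μ)
    (hν : FiniteMoment p ν) (hπ : π ∈ Adm μ ν) {f : E N → ℝ} {C : ℝ} (hC : 0 ≤ C)
    (hf : ∀ x, f x ≤ C * (1 + ‖x‖ ^ p)) : planCost (dispCost f) π < ∞ := by
  have := hπ.1
  have hm : Measurable fun x : E N => ENNReal.ofReal (‖x‖ ^ p) := by fun_prop
  have hbound : ∀ z : E N × E N, dispCost f z.1 z.2 ≤ ENNReal.ofReal C * (1 + ENNReal.ofReal (2 ^ p)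
      * (ENNReal.ofReal (‖z.1‖ ^ p) + ENNReal.ofReal (‖z.2‖ ^ p))) := fun z => by
    have hx := Real.rpow_nonneg (norm_nonneg z.1) p
    have hy := Real.rpow_nonneg (norm_nonneg z.2) p
    rw [← ENNReal.ofReal_add hx hy, ← ENNReal.ofReal_mul (by positivity), ← ENNReal.ofReal_one,
      ← ENNReal.ofReal_add zero_le_one (by positivity), ← ENNReal.ofReal_mul hC]
    refine ENNReal.ofReal_le_ofReal ((hf _).trans ?_)
    gcongr
    exact norm_sub_rpow_le hp _ _
  refine (lintegral_mono hbound).trans_lt ?_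
  rw [lintegral_const_mul _ (by fun_prop), lintegral_add_left measurable_const,
    lintegral_const_mul _ (by fun_prop), lintegral_add_left (by fun_prop)]
  have h1 : ∫⁻ z, ENNReal.ofReal (‖z.1‖ ^ p) ∂π = ∫⁻ x, ENNReal.ofReal (‖x‖ ^ p) ∂μ := by
    rw [← hπ.2.1, lintegral_map hm measurable_fst]
  have h2 : ∫⁻ z, ENNReal.ofReal (‖z.2‖ ^ p) ∂π = ∫⁻ x, ENNReal.ofReal (‖x‖ ^ p) ∂ν := by
    rw [← hπ.2.2, lintegral_map hm measurable_snd]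
  rw [h1, h2, lintegral_const, measure_univ, mul_one]
  exact ENNReal.mul_lt_top ENNReal.ofReal_lt_top (ENNReal.add_lt_top.2 ⟨ENNReal.one_lt_top,
    ENNReal.mul_lt_top ENNReal.ofReal_lt_top (ENNReal.add_lt_top.2 ⟨hμ, hν⟩)⟩)

theorem planCost_seminorm_rpow_lt_top (n : Seminorm ℝ (E N)) {p : ℝ} (hp : 1 < p)
    (hμ : FiniteMoment p μ) (hν : FiniteMoment p ν) (hπ : π ∈ Adm μ ν) :
    planCost (dispCost fun x => n x ^ p) π < ∞ := by
  obtain ⟨C, hC, hn⟩ := Seminorm.bound_of_continuous_normedSpace n (seminorm_continuous n)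
  refine planCost_dispCost_lt_top hp hμ hν hπ (C := C ^ p) (by positivity) fun x => ?_
  refine (Real.rpow_le_rpow (apply_nonneg _ _) (hn x) (by linarith)).trans ?_
  rw [Real.mul_rpow hC.le (norm_nonneg x)]
  gcongr
  linarith

theorem planCost_norm_rpow_lt_top {p q : ℝ} (hp : 1 < p) (hq : 0 ≤ q) (hqp : q ≤ p)
    (hμ : FiniteMoment p μ) (hν : FiniteMoment p ν) (hπ : π ∈ Adm μ ν) :
    planCost (dispCost fun x => ‖x‖ ^ q) π < ∞ := by
  refine planCost_dispCost_lt_top hp hμ hν hπ zero_le_one fun x => ?_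
  rw [one_mul]
  rcases le_total ‖x‖ 1 with h | h
  · linarith [Real.rpow_le_one (norm_nonneg x) h hq, Real.rpow_nonneg (norm_nonneg x) p]
  · linarith [Real.rpow_le_rpow_of_exponent_le h hqp]

theorem sqDist_eq_dispCost : (sqDist : E N → E N → ℝ≥0∞) = dispCost fun x => ‖x‖ ^ (2 : ℝ) := by
  ext x y
  rw [sqDist, dispCost, edist_dist, dist_comm, dist_eq_norm, Real.rpow_two,
    ENNReal.ofReal_pow (norm_nonneg _)]

end Moments

/-! ### The secondary problem. -/

/-- A finite secondary problem has exactly one solution, and it is induced by a map. -/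
theorem CylinderLike.plans₂_eq_singleton {N : ℕ} {n : Seminorm ℝ (E N)} (hn : CylinderLike n)
    {p : ℝ} (hp : 1 < p) {μ ν : Measure (E N)} [IsProbabilityMeasure μ] [IsProbabilityMeasure ν]
    (hμp : FiniteMoment p μ) (hνp : FiniteMoment p ν) (hμ : μ ≪ volume)
    (hsec : secondaryCost (normCost n p) μ ν < ∞) :
    ∃ π, Plans₂ (normCost n p) μ ν = {π} ∧ InducedByMap μ π := by
  have hind : ∀ π ∈ Plans₂ (normCost n p) μ ν, InducedByMap μ π := fun π hπ => by
    have hfin : planCost sqDist π < ∞ := (le_iInf₂ hπ.2).trans_lt hsec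
    have hmin := hπ.2
    rw [sqDist_eq_dispCost] at hfin hmin
    exact hn.inducedByMap hp one_lt_two hμ hπ.1 hmin
      (planCost_seminorm_rpow_lt_top n hp hμp hνp hπ.1.1) hfin
  obtain ⟨π, hπ, hmin⟩ := exists_plans₁_forall_planCost_le (μ := μ) (ν := ν)
    (continuous_dispCost (continuous_seminorm_rpow n hp))
    (continuous_dispCost (continuous_seminorm_rpow (normSeminorm ℝ (E N)) one_lt_two))
  have hπ₂ : π ∈ Plans₂ (normCost n p) μ ν := by
    refine ⟨hπ, ?_⟩
    rw [sqDist_eq_dispCost]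
    exact hmin
  refine ⟨π, Set.eq_singleton_iff_unique_mem.2 ⟨hπ₂, fun π' hπ' => ?_⟩, hind π hπ₂⟩
  exact eq_of_inducedByMap_average hπ'.1.1 hπ.1 (hind _ (average_mem_plans₂ hπ' hπ₂))

theorem CylinderLike.exists_plans₂_inducedByMap {N : ℕ} {n : Seminorm ℝ (E N)}
    (hn : CylinderLike n) {p : ℝ} (hp : 1 < p) {μ ν : Measure (E N)} [IsProbabilityMeasure μ]
    [IsProbabilityMeasure ν] (hμp : FiniteMoment p μ) (hνp : FiniteMoment p ν) (hμ : μ ≪ volume) :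
    ∃ π ∈ Plans₂ (normCost n p) μ ν, InducedByMap μ π := by
  rcases lt_or_ge (secondaryCost (normCost n p) μ ν) ∞ with hsec | hsec
  · obtain ⟨π, hπ, hind⟩ := hn.plans₂_eq_singleton hp hμp hνp hμ hsec
    exact ⟨π, hπ ▸ Set.mem_singleton π, hind⟩
  -- The tie-break `‖y - x‖ ^ p` is strictly convex and finite by the moment assumptions.
  · obtain ⟨π, hπ, hmin⟩ := exists_plans₁_forall_planCost_le (μ := μ) (ν := ν)
      (continuous_dispCost (continuous_seminorm_rpow n hp))
      (continuous_dispCost (continuous_seminorm_rpow (normSeminorm ℝ (E N)) hp))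
    refine ⟨π, ⟨hπ, fun π' hπ' => ?_⟩, hn.inducedByMap hp hp hμ hπ hmin
      (planCost_seminorm_rpow_lt_top n hp hμp hνp hπ.1)
      (planCost_norm_rpow_lt_top hp (by linarith) le_rfl hμp hνp hπ.1)⟩
    exact le_top.trans (hsec.trans (iInf₂_le π' hπ'))

theorem secondaryCost_lt_top {N : ℕ} (n : Seminorm ℝ (E N)) {p : ℝ} (hp : 2 ≤ p)
    {μ ν : Measure (E N)} [IsProbabilityMeasure μ] [IsProbabilityMeasure ν]
    (hμp : FiniteMoment p μ) (hνp : FiniteMoment p ν) :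
    secondaryCost (normCost n p) μ ν < ∞ := by
  have hp1 : 1 < p := by linarith
  obtain ⟨π, hπ, -⟩ := exists_plans₁_forall_planCost_le (μ := μ) (ν := ν)
    (continuous_dispCost (continuous_seminorm_rpow n hp1))
    (continuous_dispCost (continuous_seminorm_rpow n hp1))
  refine (iInf₂_le π hπ).trans_lt ?_
  rw [sqDist_eq_dispCost]
  exact planCost_norm_rpow_lt_top hp1 zero_le_two hp hμp hνp hπ.1

end CylTransport


theorem mainTheorem2 :
    (∀ (N : ℕ) (n : Seminorm ℝ (CylTransport.E N)),
      CylTransport.IsNorm n → CylTransport.CylinderLike n →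
      ∀ p : ℝ, 1 < p →
      ∀ μ ν : Measure (CylTransport.E N), IsProbabilityMeasure μ → IsProbabilityMeasure ν →
      CylTransport.FiniteMoment p μ → CylTransport.FiniteMoment p ν → μ ≪ volume →
        CylTransport.transportCost (CylTransport.normCost n p) μ ν < ∞ ∧
        (∃ π ∈ CylTransport.Plans₂ (CylTransport.normCost n p) μ ν,
          CylTransport.InducedByMap μ π) ∧
        (2 ≤ p ∨ CylTransport.secondaryCost (CylTransport.normCost n p) μ ν < ∞ →
          ∃ π, CylTransport.Plans₂ (CylTransport.normCost n p) μ ν = {π} ∧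
            CylTransport.InducedByMap μ π)) ∧
    (∀ n : Seminorm ℝ (CylTransport.E 2),
      CylTransport.IsNorm n → CylTransport.CylinderLike n) ∧
    (∀ (N : ℕ) (V : Finset (CylTransport.E N)),
      Submodule.span ℝ (V : Set (CylTransport.E N)) = ⊤ →
        CylTransport.IsNorm (CylTransport.crystalline V) ∧
        CylTransport.CylinderLike (CylTransport.crystalline V)) := by
  refine ⟨fun N n _ hn p hp μ ν _ _ hμp hνp hμ => ⟨?_, ?_, fun h => ?_⟩,
    fun n hn => CylTransport.cylinderLike_of_isNorm_two hn,
    fun N V hV => ⟨CylTransport.crystalline_isNorm hV, CylTransport.crystalline_cylinderLike V⟩⟩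
  · exact (iInf₂_le _ CylTransport.prod_mem_adm).trans_lt
      (CylTransport.planCost_seminorm_rpow_lt_top n hp hμp hνp CylTransport.prod_mem_adm)
  · exact hn.exists_plans₂_inducedByMap hp hμp hνp hμ
  · refine hn.plans₂_eq_singleton hp hμp hνp hμ ?_
    exact h.elim (fun h2 => CylTransport.secondaryCost_lt_top n h2 hμp hνp) id
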